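/- Let $\Bbbk$ be an algebraically closed field of characteristic zero, let $h\in\Bbbk[x]$ with $N=\deg h\ge 2$, and let $A_h$ be the $\Bbbk$-algebra generated by $x$ and $t$ subject to $tx=xt+h(x)$. Let $\psi=\gcd(h,h')$ (taken monic), let $r$ be the number of distinct roots of $h$, and let $\mathcal B=A_h[S^{-1}]$ be the Ore localization of $A_h$ at $S=\{\psi^n\mid n\ge 0\}$; $A_h$ is regarded as a subalgebra of $\mathcal B$. An element $H\in A_h$ is called special if $H=0$ or $H=h_nt^n+\dots+h_1t$ with $n\ge 1$, $h_i\in\Bbbk[x]$ and $\deg h_i<N-r$ for all $i$. For such $H$ let $E_H$ be the derivation $E_H(f)=[\psi^{-1}H,f]$ of $A_h$, where the bracket is computed in $\mathcal B$; for $w\in A_h$ let $ad_w=[w,-]$. For a derivation $D$ of $A_h$ let $\mathrm{Aut}_D(A_h)=\{\rho\in\mathrm{Aut}(A_h)\mid \rho D=D\rho\}$, where $\mathrm{Aut}$ denotes $\Bbbk$-algebra automorphisms. Every $\rho\in\mathrm{Aut}(A_h)$ extends uniquely to a $\Bbbk$-algebra automorphism of $\mathcal B$, again denoted $\rho$. Let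 $H$ be special, $w\in A_h$, $w^\ast=w+\psi^{-1}H\in\mathcal B$ and $D=ad_w+E_H$. Then $D(f)=[w^\ast,f]$ for all $f\in A_h$, and $$\mathrm{Aut}_D(A_h)=\{\rho\in\mathrm{Aut}(A_h)\mid \rho(w^\ast)-w^\ast\in\Bbbk\}.$$ In particular, $$\mathrm{Aut}_{E_H}(A_h)=\{\rho\in\mathrm{Aut}(A_h)\mid \rho(\psi^{-1}H)-\psi^{-1}H\in\Bbbk\}.$$ -/

import Mathlib

open scoped Polynomial

noncomputable section

namespace OreExt

/-! ### Derivations, inner derivations and isotropy groups of a (noncommutative) algebra -/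

section General

variable (k : Type*) [CommRing k] {R : Type*} [Ring R] [Algebra k R]

variable (R) in
/-- The `k`-derivations of the (not necessarily commutative) `k`-algebra `R`. -/
def Der : Submodule k (R →ₗ[k] R) where
  carrier := {D | ∀ a b, D (a * b) = D a * b + a * D b}
  add_mem' := by
    intro D E hD hE a b
    simp only [Set.mem_ofPred_eq] at hD hE
    simp only [LinearMap.add_apply, hD, hE]
    noncomm_ring
  zero_mem' := by intro a b; simp
  smul_mem' := by
    intro c D hD a b
    simp only [Set.mem_ofPred_eq] at hD
    simp [hD, smul_add]

/-- The inner derivation `[w, -]`. -/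
def innerDer (w : R) : Der k R :=
  ⟨LinearMap.mulLeft k w - LinearMap.mulRight k w, by
    intro a b
    simp only [LinearMap.sub_apply, LinearMap.mulLeft_apply, LinearMap.mulRight_apply]
    noncomm_ring⟩

theorem innerDer_apply (w a : R) : (innerDer k w).1 a = w * a - a * w := rfl

variable {k}

/-- The isotropy group of a derivation `D` under conjugation: the automorphisms that commute
with `D`. -/
def isotropyGroup (D : Der k R) : Subgroup (R ≃ₐ[k] R) where
  carrier := {ρ | ∀ a, ρ (D.1 a) = D.1 (ρ a)}
  mul_mem' := by
    intro ρ τ hρ hτ a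
    simp only [Set.mem_ofPred_eq] at hρ hτ
    simp [AlgEquiv.mul_apply, hρ, hτ]
  one_mem' := by intro a; rfl
  inv_mem' := by
    intro ρ hρ a
    simp only [Set.mem_ofPred_eq] at hρ
    apply ρ.injective
    rw [hρ]
    change ρ (ρ.symm _) = D.1 (ρ (ρ.symm a))
    simp

end General

/-! ### The differential Ore extension `k[x][t; h ∂ₓ]` -/

variable {k : Type*} [Field k]

/-- The defining relation `t x = x t + h(x)` on the free algebra on two generators
(`0` stands for `x`, `1` for `t`). -/
inductive Rel (h : k[X]) : FreeAlgebra k (Fin 2) → FreeAlgebra k (Fin 2) → Prop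
  | rel : Rel h (FreeAlgebra.ι k 1 * FreeAlgebra.ι k 0)
      (FreeAlgebra.ι k 0 * FreeAlgebra.ι k 1 + Polynomial.aeval (FreeAlgebra.ι k 0) h)

/-- `A_h`: the `k`-algebra generated by `x` and `t` subject to `t x = x t + h(x)`. -/
def A (h : k[X]) : Type _ := RingQuot (Rel h)

instance (h : k[X]) : Ring (A h) := inferInstanceAs (Ring (RingQuot (Rel h)))

instance (h : k[X]) : Algebra k (A h) := inferInstanceAs (Algebra k (RingQuot (Rel h)))

/-- The quotient map from the free algebra. -/
def mk (h : k[X]) : FreeAlgebra k (Fin 2) →ₐ[k] A h := RingQuot.mkAlgHom k (Rel h)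

/-- The generator `x` of `A_h`. -/
def x (h : k[X]) : A h := mk h (FreeAlgebra.ι k 0)

/-- The generator `t` of `A_h`. -/
def t (h : k[X]) : A h := mk h (FreeAlgebra.ι k 1)

/-- The polynomial `f(x)`, as an element of `A_h`. -/
def poly (h : k[X]) : k[X] →ₐ[k] A h := Polynomial.aeval (x h)

theorem poly_X (h : k[X]) : poly h Polynomial.X = x h := by simp [poly]

theorem t_mul_x (h : k[X]) : t h * x h = x h * t h + poly h h := by
  have h1 := RingQuot.mkAlgHom_rel k (Rel.rel (h := h))
  change mk h _ = mk h _ at h1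
  simp only [map_mul, map_add, ← Polynomial.aeval_algHom_apply] at h1
  exact h1

/-- The universal property of `A_h`. -/
def lift (h : k[X]) {B : Type*} [Ring B] [Algebra k B] (u v : B)
    (huv : v * u = u * v + Polynomial.aeval u h) : A h →ₐ[k] B :=
  RingQuot.liftAlgHom k ⟨FreeAlgebra.lift k ![u, v], by
    rintro _ _ ⟨⟩
    simp [← Polynomial.aeval_algHom_apply, huv]⟩

theorem lift_x (h : k[X]) {B : Type*} [Ring B] [Algebra k B] (u v : B)
    (huv : v * u = u * v + Polynomial.aeval u h) : lift h u v huv (x h) = u := by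
  change RingQuot.liftAlgHom k _ (RingQuot.mkAlgHom k (Rel h) _) = u
  rw [RingQuot.liftAlgHom_mkAlgHom_apply]
  simp

theorem lift_t (h : k[X]) {B : Type*} [Ring B] [Algebra k B] (u v : B)
    (huv : v * u = u * v + Polynomial.aeval u h) : lift h u v huv (t h) = v := by
  change RingQuot.liftAlgHom k _ (RingQuot.mkAlgHom k (Rel h) _) = v
  rw [RingQuot.liftAlgHom_mkAlgHom_apply]
  simp

theorem A_induction (h : k[X]) {P : A h → Prop} (hx : P (x h)) (ht : P (t h))
    (hc : ∀ c : k, P (algebraMap k (A h) c)) (hadd : ∀ a b, P a → P b → P (a + b))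
    (hmul : ∀ a b, P a → P b → P (a * b)) (a : A h) : P a := by
  obtain ⟨a, rfl⟩ := RingQuot.mkAlgHom_surjective k (Rel h) a
  change P (mk h a)
  induction a using FreeAlgebra.induction with
  | grade0 c => rw [AlgHom.commutes]; exact hc c
  | grade1 i => fin_cases i; exacts [hx, ht]
  | mul a b ha hb => rw [map_mul]; exact hmul _ _ ha hb
  | add a b ha hb => rw [map_add]; exact hadd _ _ ha hb

theorem poly_comm (h f g : k[X]) : poly h f * poly h g = poly h g * poly h f := by
  rw [← map_mul, mul_comm, map_mul]

theorem x_mul_poly (h f : k[X]) : x h * poly h f = poly h f * x h := by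
  rw [← poly_X, poly_comm]

theorem t_mul_poly (h f : k[X]) :
    t h * poly h f = poly h f * t h + poly h (Polynomial.derivative f * h) := by
  induction f using Polynomial.induction_on' with
  | add p q hp hq => simp only [map_add, mul_add, add_mul, hp, hq]; abel
  | monomial n a =>
    induction n with
    | zero =>
      simp only [Polynomial.monomial_zero_left, Polynomial.derivative_C, zero_mul, map_zero,
        add_zero]
      rw [← Polynomial.algebraMap_eq, AlgHom.commutes, Algebra.commutes]
    | succ n ih =>
      rw [← Polynomial.monomial_mul_X, map_mul, ← mul_assoc, ih, poly_X, Polynomial.derivative_mul,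
        Polynomial.derivative_X, mul_one, add_mul, add_mul, mul_assoc _ (t h), t_mul_x, map_add,
        mul_add, ← poly_X, mul_assoc (poly h _) _ (t h)]
      simp only [← map_mul]
      rw [mul_right_comm (Polynomial.derivative _)]
      abel

/-! ### The left `k[x]`-basis `1, t, t², …` and left cancellation of polynomials -/

/-- The action of `x` on `⨁ k[x] tⁱ`. -/
def actX : (ℕ →₀ k[X]) →ₗ[k] (ℕ →₀ k[X]) :=
  Finsupp.mapRange.linearMap (LinearMap.mulLeft k Polynomial.X)

/-- The action of `t` on `⨁ k[x] tⁱ`. -/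
def actT (h : k[X]) : (ℕ →₀ k[X]) →ₗ[k] (ℕ →₀ k[X]) :=
  Finsupp.lmapDomain k[X] k Nat.succ +
    Finsupp.mapRange.linearMap (LinearMap.mulRight k h ∘ₗ Polynomial.derivative)

theorem aeval_actX (f g : k[X]) (i : ℕ) :
    Polynomial.aeval (actX (k := k)) f (Finsupp.single i g) = Finsupp.single i (f * g) := by
  induction f using Polynomial.induction_on' with
  | add p q hp hq => simp [hp, hq, add_mul]
  | monomial n a =>
    induction n generalizing g with
    | zero => simp [Module.algebraMap_end_apply, Polynomial.smul_eq_C_mul]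
    | succ n ih =>
      rw [← Polynomial.monomial_mul_X, map_mul, Polynomial.aeval_X, Module.End.mul_apply]
      simp only [actX, Finsupp.mapRange.linearMap_apply, Finsupp.mapRange_single,
        LinearMap.mulLeft_apply] at ih ⊢
      rw [ih, mul_assoc]

/-- The action of `A_h` on `⨁ k[x] tⁱ` by left multiplication. -/
def act (h : k[X]) : A h →ₐ[k] Module.End k (ℕ →₀ k[X]) :=
  lift h actX (actT h) (by
    apply Finsupp.lhom_ext
    intro i g
    rw [LinearMap.add_apply, aeval_actX]
    simp only [actX, actT, Module.End.mul_apply, LinearMap.add_apply,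
      Finsupp.mapRange.linearMap_apply, Finsupp.mapRange_single, Finsupp.lmapDomain_apply,
      Finsupp.mapDomain_single, LinearMap.mulLeft_apply, LinearMap.comp_apply,
      LinearMap.mulRight_apply, map_add, add_assoc, ← Finsupp.single_add]
    congr 2
    simp only [Polynomial.derivative_mul, Polynomial.derivative_X]
    ring)

/-- `∑ fᵢ tⁱ` from its coefficients. -/
def ofCoeff (h : k[X]) : (ℕ →₀ k[X]) →ₗ[k] A h :=
  Finsupp.lsum k fun i => LinearMap.mulRight k (t h ^ i) ∘ₗ (poly h).toLinearMap

theorem ofCoeff_single (h : k[X]) (i : ℕ) (f : k[X]) :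
    ofCoeff h (Finsupp.single i f) = poly h f * t h ^ i := by
  simp [ofCoeff]

theorem ofCoeff_act (h : k[X]) (a : A h) (v : ℕ →₀ k[X]) :
    ofCoeff h (act h a v) = a * ofCoeff h v := by
  induction a using A_induction generalizing v with
  | hx =>
    induction v using Finsupp.induction_linear with
    | zero => simp
    | add v w hv hw => simp only [map_add, mul_add, hv, hw]
    | single i g =>
      rw [act, lift_x, actX, Finsupp.mapRange.linearMap_apply, Finsupp.mapRange_single,
        ofCoeff_single, ofCoeff_single, LinearMap.mulLeft_apply, map_mul, poly_X, mul_assoc]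
  | ht =>
    induction v using Finsupp.induction_linear with
    | zero => simp
    | add v w hv hw => simp only [map_add, mul_add, hv, hw]
    | single i g =>
      rw [act, lift_t, actT, LinearMap.add_apply, Finsupp.mapRange.linearMap_apply,
        Finsupp.mapRange_single, Finsupp.lmapDomain_apply, Finsupp.mapDomain_single, map_add,
        ofCoeff_single, ofCoeff_single, ofCoeff_single, ← mul_assoc, t_mul_poly, add_mul,
        Nat.succ_eq_add_one, pow_succ', mul_assoc]
      rfl
  | hc c => simp [Module.algebraMap_end_apply, Algebra.smul_def]
  | hadd a b ha hb => simp [add_mul, ha, hb]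
  | hmul a b ha hb => rw [map_mul, Module.End.mul_apply, ha, hb, mul_assoc]

theorem act_poly (h f : k[X]) (v : ℕ →₀ k[X]) (i : ℕ) : act h (poly h f) v i = f * v i := by
  have h1 : act h (poly h f) = Polynomial.aeval actX f := by
    rw [poly, ← Polynomial.aeval_algHom_apply, act, lift_x]
  rw [h1]
  induction v using Finsupp.induction_linear with
  | zero => simp
  | add v w hv hw => simp [mul_add, hv, hw]
  | single j g =>
    rw [aeval_actX]
    by_cases hij : j = i
    · subst hij; simp
    · simp [hij]

theorem poly_mul_cancel (h : k[X]) {f : k[X]} (hf : f ≠ 0) {a : A h} (ha : poly h f * a = 0) :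
    a = 0 := by
  have h1 : act h a (Finsupp.single 0 1) = 0 := by
    ext1 i
    have h2 := act_poly h f (act h a (Finsupp.single 0 1)) i
    rw [← Module.End.mul_apply, ← map_mul, ha] at h2
    simpa [hf] using h2.symm
  have h3 := ofCoeff_act h a (Finsupp.single 0 1)
  rw [h1, ofCoeff_single] at h3
  simpa using h3.symm

/-! ### The localization of `A_h` at the powers of `gcd(h, h')` -/

open Classical in
/-- `ψ = gcd(h, h')`, normalized to be monic. -/
def psi (h : k[X]) : k[X] := normalize (EuclideanDomain.gcd h (Polynomial.derivative h))

theorem psi_dvd (h : k[X]) : psi h ∣ h := by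
  classical
  exact normalize_dvd_iff.2 (EuclideanDomain.gcd_dvd_left _ _)

theorem psi_dvd_derivative (h : k[X]) : psi h ∣ Polynomial.derivative h := by
  classical
  exact normalize_dvd_iff.2 (EuclideanDomain.gcd_dvd_right _ _)

theorem psi_ne_zero {h : k[X]} (hh : h ≠ 0) : psi h ≠ 0 := fun h0 =>
  hh (zero_dvd_iff.1 (h0 ▸ psi_dvd h))

/-- The multiplicative set `S = {ψⁿ}` in `A_h`. -/
def psiPowers (h : k[X]) : Submonoid (A h) := Submonoid.powers (poly h (psi h))

/-- The endomorphism `x ↦ x`, `t ↦ t + g(x)` of `A_h`. -/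
def shift (h g : k[X]) : A h →ₐ[k] A h :=
  lift h (x h) (t h + poly h g) (by
    rw [add_mul, mul_add, t_mul_x, ← x_mul_poly]
    change _ = _ + poly h h
    abel)

theorem shift_poly (h g f : k[X]) : shift h g (poly h f) = poly h f := by
  rw [poly, ← Polynomial.aeval_algHom_apply, shift, lift_x]

theorem shift_shift (h g : k[X]) (a : A h) : shift h g (shift h (-g) a) = a := by
  have hg : ∀ g, shift h g (t h) = t h + poly h g := fun g => lift_t _ _ _ _
  have hx : ∀ g, shift h g (x h) = x h := fun g => lift_x _ _ _ _
  induction a using A_induction with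
  | hx => rw [hx, hx]
  | ht => simp [hg, shift_poly]
  | hc c => simp
  | hadd a b ha hb => rw [map_add, map_add, ha, hb]
  | hmul a b ha hb => rw [map_mul, map_mul, ha, hb]

theorem exists_shift (h : k[X]) :
    ∃ g : k[X], ∀ (a : A h) (n : ℕ),
      a * poly h (psi h) ^ n = poly h (psi h) ^ n * (shift h g)^[n] a := by
  obtain ⟨q, hq⟩ := psi_dvd h
  refine ⟨Polynomial.derivative (psi h) * q, fun a n => ?_⟩
  have key : ∀ a : A h, a * poly h (psi h) =
      poly h (psi h) * shift h (Polynomial.derivative (psi h) * q) a := by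
    intro a
    induction a using A_induction with
    | hx => rw [shift, lift_x, x_mul_poly]
    | ht =>
      rw [shift, lift_t, t_mul_poly, mul_add, ← map_mul]
      congr 2
      rw [mul_left_comm, ← hq]
    | hc c => rw [AlgHom.commutes, Algebra.commutes]
    | hadd a b ha hb => rw [map_add, add_mul, mul_add, ha, hb]
    | hmul a b ha hb => rw [map_mul, mul_assoc, hb, ← mul_assoc, ha, mul_assoc]
  induction n generalizing a with
  | zero => simp
  | succ n ih =>
    rw [pow_succ', ← mul_assoc, key, mul_assoc, ih, ← mul_assoc, Function.iterate_succ_apply]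

theorem ore_condition (h : k[X]) (r : A h) (s : psiPowers h) :
    ∃ (r' : A h) (s' : psiPowers h), (s' : A h) * r = r' * s := by
  obtain ⟨_, n, rfl⟩ := s
  obtain ⟨g, hg⟩ := exists_shift h
  refine ⟨(shift h (-g))^[n] r, ⟨_, n, rfl⟩, ?_⟩
  have hinv : Function.LeftInverse (shift h g) (shift h (-g)) := shift_shift h g
  change poly h (psi h) ^ n * r = _ * poly h (psi h) ^ n
  rw [hg, hinv.iterate n r]

instance (h : k[X]) : OreLocalization.OreSet (psiPowers h) where
  ore_right_cancel := by
    rintro r₁ r₂ ⟨_, n, rfl⟩ hr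
    obtain ⟨g, hg⟩ := exists_shift h
    refine ⟨⟨_, n, rfl⟩, ?_⟩
    change poly h (psi h) ^ n * r₁ = poly h (psi h) ^ n * r₂
    change r₁ * poly h (psi h) ^ n = r₂ * poly h (psi h) ^ n at hr
    rw [hg, hg] at hr
    have hinv : Function.LeftInverse (shift h (-g)) (shift h g) := by
      have := shift_shift h (-g)
      rwa [neg_neg] at this
    have hfix : ∀ m, (shift h (-g))^[m] (poly h (psi h) ^ n) = poly h (psi h) ^ n := by
      intro m
      apply Function.iterate_fixed
      rw [map_pow, shift_poly]
    have h1 := congrArg (shift h (-g))^[n] hr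
    simp only [← AlgHom.coe_pow, map_mul] at h1
    simp only [AlgHom.coe_pow, hfix, hinv.iterate n _] at h1
    exact h1
  oreNum r s := (ore_condition h r s).choose
  oreDenom r s := (ore_condition h r s).choose_spec.choose
  ore_eq r s := (ore_condition h r s).choose_spec.choose_spec

/-- The Ore localization `𝓑 = A_h[S⁻¹]`. -/
abbrev B (h : k[X]) : Type _ := OreLocalization (psiPowers h) (A h)

/-- The canonical map `A_h → 𝓑`. -/
def toB (h : k[X]) : A h →ₐ[k] B h :=
  { (OreLocalization.numeratorRingHom : A h →+* B h) with commutes' := fun _ => rfl }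

/-- The element `ψ⁻¹ u` of `𝓑`. -/
def psiInvMul (h : k[X]) (u : A h) : B h :=
  OreLocalization.oreDiv u (⟨poly h (psi h), Submonoid.mem_powers _⟩ : psiPowers h)

theorem toB_psi_mul_psiInvMul (h : k[X]) (u : A h) :
    toB h (poly h (psi h)) * psiInvMul h u = toB h u :=
  OreLocalization.mul_cancel
    (s := (⟨poly h (psi h), Submonoid.mem_powers _⟩ : psiPowers h)) (t := 1)

theorem psi_isUnit (h : k[X]) : IsUnit (toB h (poly h (psi h))) :=
  OreLocalization.numerator_isUnit
    (⟨poly h (psi h), Submonoid.mem_powers _⟩ : psiPowers h)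

theorem toB_injective {h : k[X]} (hh : h ≠ 0) : Function.Injective (toB h) := by
  apply OreLocalization.numeratorHom_inj
  rintro _ ⟨n, rfl⟩ a ha
  change poly h (psi h) ^ n * a = 0 at ha
  rw [← map_pow] at ha
  exact poly_mul_cancel h (pow_ne_zero _ (psi_ne_zero hh)) ha

/-! ### Special polynomials and the derivations `E_H` -/

/-- `H` is special: `H = hₙ tⁿ + ⋯ + h₁ t` with every `deg hᵢ < N - r`, where `N = deg h` and `r` is
the number of distinct roots of `h` (`n = 0` gives the zero polynomial). -/
def IsSpecial (h : k[X]) (H : A h) : Prop :=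
  ∃ (n : ℕ) (c : ℕ → k[X]),
    (∀ i ∈ Finset.Icc 1 n, (c i).degree < ((h.natDegree - (h.rootSet k).ncard : ℕ) : WithBot ℕ)) ∧
    H = ∑ i ∈ Finset.Icc 1 n, poly h (c i) * t h ^ i

theorem mul_h_mem (h : k[X]) (a : A h) : ∃ c, a * poly h h = poly h h * c := by
  induction a using A_induction with
  | hx => exact ⟨x h, x_mul_poly h h⟩
  | ht =>
    refine ⟨t h + poly h (Polynomial.derivative h), ?_⟩
    rw [t_mul_poly, mul_add, ← map_mul, mul_comm h]
  | hc c => exact ⟨_, Algebra.commutes _ _⟩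
  | hadd a b ha hb =>
    obtain ⟨c, hc⟩ := ha
    obtain ⟨d, hd⟩ := hb
    exact ⟨c + d, by rw [add_mul, hc, hd, mul_add]⟩
  | hmul a b ha hb =>
    obtain ⟨c, hc⟩ := ha
    obtain ⟨d, hd⟩ := hb
    exact ⟨c * d, by rw [mul_assoc, hd, ← mul_assoc, hc, mul_assoc]⟩

theorem commutator_mem_of_gen (h : k[X]) (b : A h)
    (hx : ∃ c, x h * b - b * x h = poly h h * c) (ht : ∃ c, t h * b - b * t h = poly h h * c)
    (a : A h) : ∃ c, a * b - b * a = poly h h * c := by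
  induction a using A_induction with
  | hx => exact hx
  | ht => exact ht
  | hc c => exact ⟨0, by rw [Algebra.commutes, sub_self, mul_zero]⟩
  | hadd a a' ha hb =>
    obtain ⟨c, hc⟩ := ha
    obtain ⟨d, hd⟩ := hb
    refine ⟨c + d, ?_⟩
    rw [mul_add (poly h h), ← hc, ← hd]
    noncomm_ring
  | hmul a a' ha hb =>
    obtain ⟨c, hc⟩ := ha
    obtain ⟨d, hd⟩ := hb
    obtain ⟨e, he⟩ := mul_h_mem h a
    refine ⟨e * d + c * a', ?_⟩
    have h1 : a * a' * b - b * (a * a') = a * (a' * b - b * a') + (a * b - b * a) * a' := by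
      noncomm_ring
    rw [h1, hc, hd, ← mul_assoc, he, mul_add, mul_assoc, mul_assoc]

theorem commutator_mem (h : k[X]) (a b : A h) : ∃ c, a * b - b * a = poly h h * c := by
  have hxt : ∃ c, t h * x h - x h * t h = poly h h * c := ⟨1, by rw [t_mul_x]; simp⟩
  have htx : ∃ c, x h * t h - t h * x h = poly h h * c := ⟨-1, by rw [t_mul_x]; simp⟩
  have hneg : ∀ {u v : A h}, (∃ c, u * v - v * u = poly h h * c) →
      ∃ c, v * u - u * v = poly h h * c := by
    rintro u v ⟨c, hc⟩
    exact ⟨-c, by rw [mul_neg, ← hc, neg_sub]⟩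
  refine commutator_mem_of_gen h b (hneg ?_) (hneg ?_) a
  · exact commutator_mem_of_gen h _ ⟨0, by simp⟩ hxt b
  · exact commutator_mem_of_gen h _ htx ⟨0, by simp⟩ b

theorem toB_psiInvMul (h : k[X]) (u v : A h) (huv : u = poly h (psi h) * v) :
    psiInvMul h u = toB h v := by
  apply (psi_isUnit h).mul_left_cancel
  rw [toB_psi_mul_psiInvMul, huv, map_mul]

theorem psiInvMul_eq (h : k[X]) (u : A h) : psiInvMul h u = psiInvMul h 1 * toB h u := by
  apply (psi_isUnit h).mul_left_cancel
  rw [toB_psi_mul_psiInvMul, ← mul_assoc, toB_psi_mul_psiInvMul, map_one, one_mul]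

theorem bracket_mem_range (h : k[X]) (H f : A h) :
    (innerDer k (psiInvMul h H)).1 (toB h f) ∈ (toB h).toLinearMap.range := by
  have hpsi : ∀ a : A h, ∃ c, psiInvMul h (H * a - a * H) = toB h c := by
    intro a
    obtain ⟨c, hc⟩ := commutator_mem h H a
    obtain ⟨q, hq⟩ := psi_dvd h
    refine ⟨poly h q * c, toB_psiInvMul _ _ _ ?_⟩
    rw [hc, ← mul_assoc, ← map_mul, ← hq]
  have hsplit : ∀ a : A h, (innerDer k (psiInvMul h H)).1 (toB h a) =
      psiInvMul h (H * a - a * H) + (innerDer k (psiInvMul h 1)).1 (toB h a) * toB h H := by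
    intro a
    rw [innerDer_apply, innerDer_apply, psiInvMul_eq h H, psiInvMul_eq h (H * a - a * H), map_sub,
      map_mul, map_mul]
    noncomm_ring
  induction f using A_induction with
  | hx =>
    obtain ⟨c, hc⟩ := hpsi (x h)
    refine ⟨c, ?_⟩
    rw [hsplit, hc]
    have hB := congrArg (toB h) (x_mul_poly h (psi h))
    simp only [map_mul] at hB
    have h0 : (innerDer k (psiInvMul h 1)).1 (toB h (x h)) = 0 := by
      apply (psi_isUnit h).mul_left_cancel
      rw [innerDer_apply, mul_sub, ← mul_assoc, toB_psi_mul_psiInvMul, ← mul_assoc, ← hB,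
        mul_assoc (toB h (x h)), toB_psi_mul_psiInvMul]
      simp
    rw [h0, zero_mul, add_zero]
    rfl
  | ht =>
    obtain ⟨c, hc⟩ := hpsi (t h)
    obtain ⟨q, hq⟩ := psi_dvd h
    obtain ⟨g, hg⟩ : psi h ∣ Polynomial.derivative (psi h) * q := by
      have h1 := psi_dvd_derivative h
      have h2 : Polynomial.derivative h =
          Polynomial.derivative (psi h) * q + psi h * Polynomial.derivative q := by
        conv_lhs => rw [hq]
        rw [Polynomial.derivative_mul]
      rw [h2] at h1
      exact (dvd_add_left (dvd_mul_right _ _)).1 h1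
    have h0 : (innerDer k (psiInvMul h 1)).1 (toB h (t h)) = toB h (poly h g) := by
      have hl : toB h (poly h (psi h)) * psiInvMul h 1 = 1 := by
        rw [toB_psi_mul_psiInvMul, map_one]
      have hr : psiInvMul h 1 * toB h (poly h (psi h)) = 1 := by
        apply (psi_isUnit h).mul_left_cancel
        rw [← mul_assoc, hl, one_mul, mul_one]
      have hcomm : t h * poly h (psi h) =
          poly h (psi h) * t h + poly h (psi h) * poly h g * poly h (psi h) := by
        rw [t_mul_poly, ← map_mul, ← map_mul, ← hg]
        rw [mul_right_comm, mul_assoc, ← hq]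
      have hB := congrArg (toB h) hcomm
      simp only [map_add, map_mul] at hB
      apply (psi_isUnit h).mul_left_cancel
      apply (psi_isUnit h).mul_right_cancel
      rw [innerDer_apply, mul_sub, sub_mul, ← mul_assoc, hl, one_mul, hB]
      have h3 : toB h (poly h (psi h)) * (toB h (t h) * psiInvMul h 1) * toB h (poly h (psi h)) =
          toB h (poly h (psi h)) * toB h (t h) := by
        rw [mul_assoc, mul_assoc (toB h (t h)), hr, mul_one]
      rw [h3, add_sub_cancel_left]
    refine ⟨c + poly h g * H, ?_⟩
    rw [hsplit, hc, h0, ← map_mul, ← map_add]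
    rfl
  | hc c =>
    rw [AlgHom.commutes, innerDer_apply, Algebra.commutes, sub_self]
    exact zero_mem _
  | hadd a b ha hb => rw [map_add, map_add]; exact add_mem ha hb
  | hmul a b ha hb =>
    obtain ⟨c, hc⟩ := ha
    obtain ⟨d, hd⟩ := hb
    refine ⟨c * b + a * d, ?_⟩
    rw [map_mul, (innerDer k (psiInvMul h H)).2, ← hc, ← hd]
    simp

/-- The linear map `E_H = [ψ⁻¹ H, -] : A_h → A_h`. -/
def specialMap (h : k[X]) (hh : h ≠ 0) (H : A h) : A h →ₗ[k] A h :=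
  (LinearEquiv.ofInjective (toB h).toLinearMap (toB_injective hh)).symm.toLinearMap ∘ₗ
    LinearMap.codRestrict (toB h).toLinearMap.range
      ((innerDer k (psiInvMul h H)).1 ∘ₗ (toB h).toLinearMap) (bracket_mem_range h H)

/-- In `𝓑` one has `E_H(f) = [ψ⁻¹ H, f]`. -/
theorem toB_specialMap (h : k[X]) (hh : h ≠ 0) (H f : A h) :
    toB h (specialMap h hh H f) = psiInvMul h H * toB h f - toB h f * psiInvMul h H := by
  change (toB h).toLinearMap _ = _
  simp only [specialMap, LinearMap.comp_apply]
  exact LinearEquiv.ofInjective_symm_apply (f := (toB h).toLinearMap) (h := toB_injective hh) _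

/-- The derivation `E_H` of `A_h`. -/
def specialDer (h : k[X]) (hh : h ≠ 0) (H : A h) : Der k (A h) :=
  ⟨specialMap h hh H, by
    intro a b
    apply toB_injective hh
    simp only [map_add, map_mul, toB_specialMap]
    noncomm_ring⟩

/-- `σ` extends the automorphism `ρ` of `A_h` to `𝓑`. -/
def IsExtension {h : k[X]} (ρ : A h ≃ₐ[k] A h) (σ : B h ≃ₐ[k] B h) : Prop :=
  ∀ a, σ (toB h a) = toB h (ρ a)

/-- The element `w* = w + ψ⁻¹ H` of `𝓑`. -/
def wStar (h : k[X]) (w H : A h) : B h := toB h w + psiInvMul h H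

end OreExt

end

/-!
Everything takes place in the left `k[x]`-basis `1, t, t², …` of `A_h`. The degree in `t` is additive
on products (`tdeg_mul`), so `A_h` is a domain whose units lie in `k[x]`.

*Extension.* Since `h = [t, x]` and all commutators lie in `h A_h`, an automorphism `ρ` multiplies
`h` by a unit `e`, and `e ∈ k[x]`. As `ρ(h)` has degree zero in `t`, so has its factor `ρ(x) - s`, for
`s` a root of `h`; hence `ρ(x) = p(x)` (`exists_map_x`). From `h(p) = h e` it follows that `ψ(p)`
divides `h` and, after differentiation, `h'`; so `ψ(p)` divides `ψ` and `ρ(ψ) = ψ(p)` is invertible in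
`𝓑` (`isUnit_toB_map_psi`). The universal property of the localization then extends `ρ` and `ρ⁻¹`
to mutually inverse maps (`existsUnique_extension`).

*Isotropy.* If `D = [u, -]` on `A_h` with `u ∈ 𝓑`, and `σ` extends `ρ`, then
`ρ(D f) - D(ρ f) = [σ(u) - u, ρ(f)]`, so `ρ` commutes with `D` exactly when `σ(u) - u` commutes with
`A_h`. Such elements are scalars (`exists_eq_algebraMap_of_commute`): commuting with `x` forces
`f / ψⁿ` with `f ∈ k[x]`, by the leading term of `[tᵐ, x] = m h tᵐ⁻¹ + ⋯` in characteristic zero, and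
commuting with `t` forces `(f / ψⁿ)' = 0`.
-/

noncomputable section

namespace OreExt

variable {k : Type*} [Field k]

/-! ### Degree in `t` -/

/-- The coefficients of an element of `A_h` in the left `k[x]`-basis `1, t, t², …`. -/
def coeff (h : k[X]) : A h →ₗ[k] (ℕ →₀ k[X]) :=
  LinearMap.applyₗ (Finsupp.single 0 1) ∘ₗ (act h).toLinearMap

theorem coeff_apply (h : k[X]) (a : A h) : coeff h a = act h a (Finsupp.single 0 1) := rfl

theorem ofCoeff_coeff (h : k[X]) (a : A h) : ofCoeff h (coeff h a) = a := by
  rw [coeff_apply, ofCoeff_act, ofCoeff_single]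
  simp

theorem coeff_injective (h : k[X]) : Function.Injective (coeff h) :=
  Function.LeftInverse.injective (ofCoeff_coeff h)

theorem coeff_mul (h : k[X]) (a b : A h) : coeff h (a * b) = act h a (coeff h b) := by
  rw [coeff_apply, map_mul, Module.End.mul_apply, coeff_apply]

theorem coeff_poly (h f : k[X]) (i : ℕ) : coeff h (poly h f) i = if i = 0 then f else 0 := by
  rw [coeff_apply, act_poly, Finsupp.single_apply]
  by_cases hi : i = 0 <;> simp [hi, eq_comm]

theorem poly_injective (h : k[X]) : Function.Injective (poly h) := by
  intro f g hfg
  simpa [coeff_poly] using congrArg (fun a => coeff h a 0) hfg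

theorem act_t_zero (h : k[X]) (v : ℕ →₀ k[X]) :
    act h (t h) v 0 = Polynomial.derivative (v 0) * h := by
  rw [act, lift_t, actT, LinearMap.add_apply, Finsupp.add_apply, Finsupp.lmapDomain_apply,
    Finsupp.mapDomain_of_notMem_range _ _ (by simp)]
  simp

theorem act_t_succ (h : k[X]) (v : ℕ →₀ k[X]) (i : ℕ) :
    act h (t h) v (i + 1) = v i + Polynomial.derivative (v (i + 1)) * h := by
  rw [act, lift_t, actT, LinearMap.add_apply, Finsupp.add_apply, Finsupp.lmapDomain_apply,
    ← Nat.succ_eq_add_one, Finsupp.mapDomain_apply Nat.succ_injective]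
  simp

theorem act_t_pow_of_gt (h : k[X]) {v : ℕ →₀ k[X]} {m : ℕ} (hv : ∀ i, m < i → v i = 0) (n : ℕ)
    {i : ℕ} (hi : n + m < i) : act h (t h ^ n) v i = 0 := by
  induction n generalizing i with
  | zero => simpa using hv i (by omega)
  | succ n ih =>
    obtain ⟨i, rfl⟩ := Nat.exists_eq_add_of_lt hi
    rw [pow_succ', map_mul, Module.End.mul_apply, act_t_succ, ih (by omega), ih (by omega)]
    simp

theorem act_t_pow_top (h : k[X]) {v : ℕ →₀ k[X]} {m : ℕ} (hv : ∀ i, m < i → v i = 0) (n : ℕ) :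
    act h (t h ^ n) v (n + m) = v m := by
  induction n with
  | zero => simp
  | succ n ih =>
    rw [pow_succ', map_mul, Module.End.mul_apply, add_right_comm, act_t_succ, ih,
      act_t_pow_of_gt h hv n (by omega)]
    simp

theorem act_eq_sum (h : k[X]) {a : A h} {n : ℕ} (ha : ∀ i, n < i → coeff h a i = 0)
    (v : ℕ →₀ k[X]) (j : ℕ) :
    act h a v j = ∑ i ∈ Finset.range (n + 1), coeff h a i * act h (t h ^ i) v j := by
  conv_lhs => rw [← ofCoeff_coeff h a]
  have hsub : (coeff h a).support ⊆ Finset.range (n + 1) := by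
    intro i hi
    by_contra hn
    exact Finsupp.mem_support_iff.1 hi (ha i (by simpa using hn))
  rw [ofCoeff, Finsupp.lsum_apply, Finsupp.sum_of_support_subset _ hsub _ (by simp)]
  simp only [map_sum, LinearMap.sum_apply, Finsupp.finsetSum_apply]
  refine Finset.sum_congr rfl fun i _ => ?_
  simp only [LinearMap.comp_apply, AlgHom.toLinearMap_apply, LinearMap.mulRight_apply, map_mul,
    Module.End.mul_apply, act_poly]

/-- The degree in `t` of an element of `A_h`; the zero element has degree `0`. -/
def tdeg (h : k[X]) (a : A h) : ℕ := (coeff h a).support.sup id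

theorem coeff_of_tdeg_lt {h : k[X]} {a : A h} {i : ℕ} (hi : tdeg h a < i) : coeff h a i = 0 := by
  by_contra hn
  exact absurd (Finset.le_sup (f := id) (Finsupp.mem_support_iff.2 hn)) (not_le.2 hi)

theorem coeff_tdeg_ne_zero {h : k[X]} {a : A h} (ha : a ≠ 0) : coeff h a (tdeg h a) ≠ 0 := by
  have hne : (coeff h a).support.Nonempty := by
    rw [Finsupp.support_nonempty_iff]
    exact fun h0 => ha (coeff_injective h (by rw [h0, map_zero]))
  obtain ⟨i, hi, hi'⟩ := Finset.exists_mem_eq_sup _ hne id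
  rw [tdeg, hi']
  exact Finsupp.mem_support_iff.1 hi

theorem tdeg_eq_of_coeff {h : k[X]} {a : A h} {n : ℕ} (hn : coeff h a n ≠ 0)
    (hgt : ∀ i, n < i → coeff h a i = 0) : tdeg h a = n := by
  apply le_antisymm
  · by_contra! hlt
    have ha : a ≠ 0 := by rintro rfl; simp at hn
    exact coeff_tdeg_ne_zero ha (hgt _ hlt)
  · exact Finset.le_sup (f := id) (Finsupp.mem_support_iff.2 hn)

theorem tdeg_poly (h f : k[X]) : tdeg h (poly h f) = 0 := by
  by_contra hn
  have hne : poly h f ≠ 0 := by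
    rintro h0
    simp [tdeg, h0] at hn
  exact coeff_tdeg_ne_zero hne (by rw [coeff_poly, if_neg hn])

theorem eq_poly_of_tdeg_eq_zero {h : k[X]} {a : A h} (ha : tdeg h a = 0) :
    a = poly h (coeff h a 0) := by
  apply coeff_injective h
  ext1 i
  rw [coeff_poly]
  split_ifs with hi
  · rw [hi]
  · exact coeff_of_tdeg_lt (by omega)

theorem coeff_mul_of_gt {h : k[X]} (a b : A h) {j : ℕ} (hj : tdeg h a + tdeg h b < j) :
    coeff h (a * b) j = 0 := by
  rw [coeff_mul, act_eq_sum h (fun i => coeff_of_tdeg_lt)]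
  refine Finset.sum_eq_zero fun i hi => ?_
  rw [Finset.mem_range] at hi
  rw [act_t_pow_of_gt h (fun i => coeff_of_tdeg_lt) i (by omega), mul_zero]

theorem coeff_mul_top {h : k[X]} (a b : A h) :
    coeff h (a * b) (tdeg h a + tdeg h b) =
      coeff h a (tdeg h a) * coeff h b (tdeg h b) := by
  rw [coeff_mul, act_eq_sum h (fun i => coeff_of_tdeg_lt), Finset.sum_range_succ,
    act_t_pow_top h (fun i => coeff_of_tdeg_lt), add_eq_right]
  refine Finset.sum_eq_zero fun i hi => ?_
  rw [Finset.mem_range] at hi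
  rw [act_t_pow_of_gt h (fun i => coeff_of_tdeg_lt) i (by omega), mul_zero]

instance (h : k[X]) : NoZeroDivisors (A h) where
  eq_zero_or_eq_zero_of_mul_eq_zero := by
    intro a b hab
    by_contra! hn
    have h1 := coeff_mul_top a b
    rw [hab, map_zero, Finsupp.zero_apply] at h1
    exact mul_ne_zero (coeff_tdeg_ne_zero hn.1) (coeff_tdeg_ne_zero hn.2) h1.symm

theorem tdeg_mul {h : k[X]} {a b : A h} (ha : a ≠ 0) (hb : b ≠ 0) :
    tdeg h (a * b) = tdeg h a + tdeg h b := by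
  refine tdeg_eq_of_coeff ?_ fun i => coeff_mul_of_gt a b
  rw [coeff_mul_top]
  exact mul_ne_zero (coeff_tdeg_ne_zero ha) (coeff_tdeg_ne_zero hb)

theorem poly_ne_zero (h : k[X]) {f : k[X]} (hf : f ≠ 0) : poly h f ≠ 0 := fun h0 =>
  hf (poly_injective h (h0.trans (map_zero _).symm))

theorem tdeg_eq_zero_of_mul {h : k[X]} {a b : A h} (hab : a * b ≠ 0) (h0 : tdeg h (a * b) = 0) :
    tdeg h a = 0 ∧ tdeg h b = 0 := by
  rw [tdeg_mul (left_ne_zero_of_mul hab) (right_ne_zero_of_mul hab)] at h0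
  omega

/-! ### Automorphisms of `A_h` preserve `k[x]` and the class of `ψ` -/

/-- `h = [t, x]`, and commutators lie in `h A_h`; so an endomorphism sends `h` into `h A_h`. -/
theorem exists_map_h (h : k[X]) (ρ : A h →ₐ[k] A h) : ∃ c, ρ (poly h h) = poly h h * c := by
  obtain ⟨c, hc⟩ := commutator_mem h (ρ (t h)) (ρ (x h))
  refine ⟨c, ?_⟩
  rw [← hc, ← map_mul, ← map_mul, ← map_sub, t_mul_x, add_sub_cancel_left]

theorem map_poly_eq {h p : k[X]} {ρ : A h →ₐ[k] A h} (hx : ρ (x h) = poly h p) (f : k[X]) :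
    ρ (poly h f) = poly h (f.comp p) := by
  rw [poly, ← Polynomial.aeval_algHom_apply, hx, Polynomial.aeval_algHom_apply, poly,
    ← Polynomial.comp_eq_aeval]

/-- An automorphism sends `x` to a polynomial `p(x)`, and `h(p)` is `h` up to a unit. -/
theorem exists_map_x [IsAlgClosed k] {h : k[X]} (hN : h.natDegree ≠ 0) (ρ : A h ≃ₐ[k] A h) :
    ∃ p e : k[X], ρ (x h) = poly h p ∧ IsUnit e ∧ h.comp p = h * e := by
  have hh : h ≠ 0 := by rintro rfl; simp at hN
  obtain ⟨u, hu⟩ := exists_map_h h ρ.toAlgHom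
  obtain ⟨v, hv⟩ := exists_map_h h ρ.symm.toAlgHom
  change ρ (poly h h) = poly h h * u at hu
  change ρ.symm (poly h h) = poly h h * v at hv
  have huv : u * ρ v = 1 := by
    have h1 := congrArg ρ hv
    rw [AlgEquiv.apply_symm_apply, map_mul, hu, mul_assoc] at h1
    exact (mul_left_cancel₀ (poly_ne_zero h hh) ((mul_one _).trans h1)).symm
  have h1 : (1 : A h) = poly h 1 := (map_one _).symm
  have huv0 : tdeg h u = 0 ∧ tdeg h (ρ v) = 0 := by
    apply tdeg_eq_zero_of_mul
    · rw [huv, h1]; exact poly_ne_zero h one_ne_zero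
    · rw [huv, h1, tdeg_poly]
  have hu' := eq_poly_of_tdeg_eq_zero huv0.1
  have hv' := eq_poly_of_tdeg_eq_zero huv0.2
  set e := coeff h u 0
  have hunit : IsUnit e := by
    refine IsUnit.of_mul_eq_one (coeff h (ρ v) 0) (poly_injective h ?_)
    rw [map_mul, ← hu', ← hv', huv, h1]
  -- `h(x)` has a linear factor `x - s`, so `ρ(x) - s` divides `ρ(h)`, which has `t`-degree zero.
  obtain ⟨s, hs⟩ := IsAlgClosed.exists_root h (by
    rw [Polynomial.degree_eq_natDegree hh]
    exact_mod_cast hN)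
  obtain ⟨q, hq⟩ := Polynomial.dvd_iff_isRoot.2 hs
  have hρ : ρ (poly h (Polynomial.X - Polynomial.C s)) * ρ (poly h q) = poly h (h * e) := by
    rw [← map_mul, ← map_mul, ← hq, hu, map_mul, ← hu']
  have hx0 : tdeg h (ρ (poly h (Polynomial.X - Polynomial.C s))) = 0 := by
    refine (tdeg_eq_zero_of_mul (b := ρ (poly h q)) ?_ ?_).1
    · rw [hρ]; exact poly_ne_zero h (mul_ne_zero hh hunit.ne_zero)
    · rw [hρ, tdeg_poly]
  have hx1 := eq_poly_of_tdeg_eq_zero hx0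
  set p₀ := coeff h (ρ (poly h (Polynomial.X - Polynomial.C s))) 0
  have hx : ρ (x h) = poly h (p₀ + Polynomial.C s) := by
    have hC : ∀ s : k, poly h (Polynomial.C s) = algebraMap k (A h) s := fun s => by
      rw [← Polynomial.algebraMap_eq, AlgHom.commutes]
    rw [map_sub, map_sub, poly_X, hC, AlgEquiv.commutes, sub_eq_iff_eq_add] at hx1
    rw [hx1, map_add, hC]
  refine ⟨_, e, hx, hunit, poly_injective h ?_⟩
  rw [map_mul, ← hu', ← hu]
  exact (map_poly_eq (ρ := ρ.toAlgHom) hx h).symm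

theorem dvd_psi {h d : k[X]} (h1 : d ∣ h) (h2 : d ∣ Polynomial.derivative h) : d ∣ psi h := by
  classical
  exact dvd_normalize_iff.2 (EuclideanDomain.dvd_gcd h1 h2)

theorem psi_comp_dvd {h p e : k[X]} (he : IsUnit e) (hp : h.comp p = h * e) :
    (psi h).comp p ∣ psi h := by
  have hcomp : ∀ {f g : k[X]}, f ∣ g → f.comp p ∣ g.comp p := by
    rintro f _ ⟨c, rfl⟩
    exact ⟨c.comp p, Polynomial.mul_comp _ _ _⟩
  have h1 : (psi h).comp p ∣ h := by
    have := hcomp (psi_dvd h)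
    rwa [hp, he.dvd_mul_right] at this
  refine dvd_psi h1 ?_
  have h2 : (psi h).comp p ∣ Polynomial.derivative (h * e) := by
    rw [← hp, Polynomial.derivative_comp]
    exact (hcomp (psi_dvd_derivative h)).mul_left _
  rw [Polynomial.derivative_mul] at h2
  exact he.dvd_mul_right.1 ((dvd_add_left (h1.mul_right _)).1 h2)

theorem isUnit_toB_map_psi [IsAlgClosed k] {h : k[X]} (hN : h.natDegree ≠ 0)
    (ρ : A h ≃ₐ[k] A h) : IsUnit (toB h (ρ (poly h (psi h)))) := by
  obtain ⟨p, e, hx, he, hp⟩ := exists_map_x hN ρ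
  obtain ⟨q, hq⟩ := psi_comp_dvd he hp
  have h1 : ρ (poly h (psi h)) = poly h ((psi h).comp p) :=
    map_poly_eq (ρ := ρ.toAlgHom) hx (psi h)
  have h2 := psi_isUnit h
  rw [hq, map_mul, map_mul] at h2
  rw [h1]
  refine ((Commute.isUnit_mul_iff ?_).1 h2).1
  exact Commute.map (poly_comm h _ _) (toB h)

/-! ### Extension of automorphisms to the localization -/

theorem exists_toB_mul (h : k[X]) (b : B h) :
    ∃ (n : ℕ) (a : A h), toB h (poly h (psi h ^ n)) * b = toB h a := by
  induction b using OreLocalization.ind with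
  | c a s =>
    obtain ⟨_, n, rfl⟩ := s
    refine ⟨n, a, ?_⟩
    rw [map_pow (poly h)]
    exact OreLocalization.mul_cancel
      (s := (⟨poly h (psi h) ^ n, n, rfl⟩ : psiPowers h)) (t := 1)

theorem psi_pow_isUnit (h : k[X]) (n : ℕ) : IsUnit (toB h (poly h (psi h ^ n))) := by
  rw [map_pow, map_pow]
  exact (psi_isUnit h).pow n

theorem B_algHom_ext {h : k[X]} {C : Type*} [Ring C] [Algebra k C] {φ φ' : B h →ₐ[k] C}
    (hφ : ∀ a, φ (toB h a) = φ' (toB h a)) : φ = φ' := by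
  ext1 b
  obtain ⟨n, a, hb⟩ := exists_toB_mul h b
  apply ((psi_pow_isUnit h n).map φ).mul_left_cancel
  rw [← map_mul, hb, hφ, hφ, ← map_mul, hb]

theorem exists_algHom_extension [IsAlgClosed k] {h : k[X]} (hN : h.natDegree ≠ 0)
    (ρ : A h ≃ₐ[k] A h) : ∃ φ : B h →ₐ[k] B h, ∀ a, φ (toB h a) = toB h (ρ a) := by
  let f : A h →+* B h := ((toB h).comp ρ.toAlgHom).toRingHom
  have hf : ∀ s : psiPowers h, IsUnit ((f : A h →* B h).comp (psiPowers h).subtype s) := by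
    rintro ⟨_, n, rfl⟩
    change IsUnit (toB h (ρ (poly h (psi h) ^ n)))
    rw [map_pow, map_pow]
    exact (isUnit_toB_map_psi hN ρ).pow n
  have hcomm : ∀ a : A h, OreLocalization.universalHom f (IsUnit.liftRight _ hf) (fun _ => rfl)
      (toB h a) = toB h (ρ a) := fun a => OreLocalization.universalHom_commutes _ _ _
  refine ⟨{ OreLocalization.universalHom f (IsUnit.liftRight _ hf) (fun _ => rfl) with
    commutes' := fun c => ?_ }, hcomm⟩
  have h1 := hcomm (algebraMap k (A h) c)
  rw [AlgEquiv.commutes, AlgHom.commutes] at h1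
  exact h1

theorem existsUnique_extension [IsAlgClosed k] {h : k[X]} (hN : h.natDegree ≠ 0)
    (ρ : A h ≃ₐ[k] A h) : ∃! σ : B h ≃ₐ[k] B h, IsExtension ρ σ := by
  obtain ⟨φ, hφ⟩ := exists_algHom_extension hN ρ
  obtain ⟨φ', hφ'⟩ := exists_algHom_extension hN ρ.symm
  refine ⟨AlgEquiv.ofAlgHom φ φ' (B_algHom_ext ?_) (B_algHom_ext ?_), hφ, fun σ hσ => ?_⟩
  · intro a; simp [hφ, hφ']
  · intro a; simp [hφ, hφ']
  · have h1 : (σ : B h →ₐ[k] B h) = φ := B_algHom_ext fun a => (hσ a).trans (hφ a).symm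
    ext1 b
    exact DFunLike.congr_fun h1 b

/-! ### The centre of the localization -/

/-- The coefficient of `tⁿ⁺¹ x = x tⁿ⁺¹ + (n + 1) h tⁿ + ⋯` at `tⁿ`. -/
theorem act_t_pow_single_X (h : k[X]) (n : ℕ) :
    act h (t h ^ (n + 1)) (Finsupp.single 0 Polynomial.X) n = ((n + 1 : ℕ) : k[X]) * h := by
  have hv : ∀ i, 0 < i → (Finsupp.single 0 Polynomial.X : ℕ →₀ k[X]) i = 0 := fun i hi => by
    rw [Finsupp.single_apply, if_neg (by omega)]
  induction n with
  | zero => simp [act_t_zero]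
  | succ n ih =>
    have htop := act_t_pow_top h hv (n + 1)
    rw [add_zero, Finsupp.single_eq_same] at htop
    rw [pow_succ', map_mul, Module.End.mul_apply, act_t_succ, ih, htop, Polynomial.derivative_X]
    push_cast
    ring

/-- In characteristic zero the centralizer of `x` is `k[x]`. -/
theorem eq_poly_of_commute_x [CharZero k] {h : k[X]} (hh : h ≠ 0) {a : A h}
    (ha : a * x h = x h * a) : ∃ f, a = poly h f := by
  refine ⟨_, eq_poly_of_tdeg_eq_zero ?_⟩
  by_contra hd
  obtain ⟨n, hn⟩ := Nat.exists_eq_succ_of_ne_zero hd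
  have ha0 : a ≠ 0 := by rintro rfl; simp [tdeg] at hd
  have hlead := coeff_tdeg_ne_zero ha0
  rw [hn] at hlead
  have hv : ∀ i, 0 < i → (Finsupp.single 0 Polynomial.X : ℕ →₀ k[X]) i = 0 := fun i hi => by
    rw [Finsupp.single_apply, if_neg (by omega)]
  have hX : coeff h (x h) = Finsupp.single 0 Polynomial.X := by
    ext1 i
    rw [← poly_X, coeff_poly, Finsupp.single_apply]
    simp [eq_comm]
  have hl : coeff h (a * x h) n =
      coeff h a n * Polynomial.X + coeff h a (n + 1) * (((n + 1 : ℕ) : k[X]) * h) := by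
    rw [coeff_mul, hX, act_eq_sum h (n := n + 1) fun i hi => coeff_of_tdeg_lt (by omega),
      Finset.sum_range_succ, Finset.sum_range_succ, act_t_pow_single_X,
      Finset.sum_eq_zero, zero_add]
    · have htop := act_t_pow_top h hv n
      rw [add_zero, Finsupp.single_eq_same] at htop
      rw [htop]
    · intro i hi
      rw [Finset.mem_range] at hi
      rw [act_t_pow_of_gt h hv i (by omega), mul_zero]
  have hr : coeff h (x h * a) n = Polynomial.X * coeff h a n := by
    rw [coeff_mul, ← poly_X, act_poly]
  rw [ha, hr, mul_comm, left_eq_add] at hl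
  exact mul_ne_zero hlead (mul_ne_zero (Nat.cast_ne_zero.2 n.succ_ne_zero) hh) hl

/-- Comparison of leading coefficients in `f' s = f s'`. -/
theorem natDegree_eq_of_derivative_mul_eq [CharZero k] {f s : k[X]} (hf : f ≠ 0) (hs : s ≠ 0)
    (hfs : Polynomial.derivative f * s = f * Polynomial.derivative s) :
    f.natDegree = s.natDegree := by
  by_cases hf0 : f.natDegree = 0
  · rw [Polynomial.derivative_eq_zero.2 hf0, zero_mul, eq_comm, mul_eq_zero, or_iff_right hf] at hfs
    rw [hf0, Polynomial.derivative_eq_zero.1 hfs]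
  by_cases hs0 : s.natDegree = 0
  · rw [Polynomial.derivative_eq_zero.2 hs0, mul_zero, mul_eq_zero, or_iff_left hs] at hfs
    rw [hs0, Polynomial.derivative_eq_zero.1 hfs]
  have h1 := congrArg Polynomial.leadingCoeff hfs
  rw [Polynomial.leadingCoeff_mul, Polynomial.leadingCoeff_mul] at h1
  have hlead : ∀ g : k[X], g.natDegree ≠ 0 →
      (Polynomial.derivative g).leadingCoeff = g.leadingCoeff * g.natDegree := by
    intro g hg
    rw [Polynomial.leadingCoeff, Polynomial.natDegree_derivative,
      Polynomial.coeff_derivative, ← Nat.cast_succ, Nat.succ_eq_add_one, Nat.sub_add_cancel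
      (Nat.one_le_iff_ne_zero.2 hg)]
    rfl
  rw [hlead f hf0, hlead s hs0] at h1
  have h2 : f.leadingCoeff * s.leadingCoeff * ((f.natDegree : k) - s.natDegree) = 0 := by
    linear_combination h1
  rw [mul_eq_zero, or_iff_right (mul_ne_zero (by simpa using hf) (by simpa using hs)),
    sub_eq_zero] at h2
  exact_mod_cast h2

/-- `(f / s)' = 0` only when `f / s` is a constant. -/
theorem exists_eq_C_mul_of_derivative_mul_eq [CharZero k] {f s : k[X]} (hs : s ≠ 0)
    (hfs : Polynomial.derivative f * s = f * Polynomial.derivative s) :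
    ∃ c : k, f = Polynomial.C c * s := by
  by_cases hf : f = 0
  · exact ⟨0, by simp [hf]⟩
  have hdeg := natDegree_eq_of_derivative_mul_eq hf hs hfs
  have hsl : s.leadingCoeff ≠ 0 := Polynomial.leadingCoeff_ne_zero.2 hs
  refine ⟨f.leadingCoeff / s.leadingCoeff, sub_eq_zero.1 ?_⟩
  -- The difference again solves the equation, but its coefficient in the common degree vanishes.
  set c := f.leadingCoeff / s.leadingCoeff with hc
  by_contra hg
  have hgs : Polynomial.derivative (f - Polynomial.C c * s) * s =
      (f - Polynomial.C c * s) * Polynomial.derivative s := by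
    simp only [Polynomial.derivative_sub, Polynomial.derivative_C_mul]
    linear_combination hfs
  have hdeg' := natDegree_eq_of_derivative_mul_eq hg hs hgs
  refine Polynomial.leadingCoeff_ne_zero.2 hg ?_
  rw [Polynomial.leadingCoeff, hdeg', Polynomial.coeff_sub, Polynomial.coeff_C_mul]
  nth_rewrite 1 [← hdeg]
  rw [Polynomial.coeff_natDegree, Polynomial.coeff_natDegree, hc, div_mul_cancel₀ _ hsl, sub_self]

/-- An element of `𝓑` that commutes with `A_h` is a scalar. -/
theorem exists_eq_algebraMap_of_commute [CharZero k] {h : k[X]} (hh : h ≠ 0) {u : B h}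
    (hu : ∀ a, u * toB h a = toB h a * u) : ∃ c : k, u = algebraMap k (B h) c := by
  obtain ⟨n, a, ha⟩ := exists_toB_mul h u
  set s := psi h ^ n with hsdef
  have hs : s ≠ 0 := pow_ne_zero _ (psi_ne_zero hh)
  have hax : a * x h = x h * a := by
    apply toB_injective hh
    rw [map_mul, map_mul, ← ha, mul_assoc, hu, ← mul_assoc, ← mul_assoc, ← map_mul, ← map_mul,
      x_mul_poly]
  obtain ⟨f, rfl⟩ := eq_poly_of_commute_x hh hax
  -- With `u = s⁻¹ f`, the relation `[t, f] = u [t, s]` multiplied by `s` is `h s f' = h f s'`.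
  have hfs : Polynomial.derivative f * s = f * Polynomial.derivative s := by
    have hbr : ∀ g : k[X], poly h (Polynomial.derivative g * h) =
        t h * poly h g - poly h g * t h := fun g => by
      rw [t_mul_poly, add_sub_cancel_left]
    have h1 : toB h (poly h s * poly h (Polynomial.derivative f * h)) =
        toB h (poly h f * poly h (Polynomial.derivative s * h)) := by
      rw [map_mul (toB h) (poly h s), map_mul (toB h) (poly h f), ← ha, mul_assoc,
        hu (poly h (Polynomial.derivative s * h)), hbr, hbr]
      simp only [map_sub, map_mul, ← ha, sub_mul, mul_assoc, hu]
    have h2 := toB_injective hh h1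
    rw [← map_mul, ← map_mul] at h2
    apply mul_right_cancel₀ hh
    linear_combination poly_injective h h2
  obtain ⟨c, rfl⟩ := exists_eq_C_mul_of_derivative_mul_eq hs hfs
  refine ⟨c, (psi_pow_isUnit h n).mul_left_cancel ?_⟩
  rw [← hsdef, ha, map_mul, map_mul, ← Polynomial.algebraMap_eq, AlgHom.commutes, AlgHom.commutes,
    Algebra.commutes]

/-! ### Isotropy groups -/

theorem toB_innerDer_add_specialDer {h : k[X]} (hh : h ≠ 0) (w H f : A h) :
    toB h ((innerDer k w + specialDer h hh H).1 f) =
      (innerDer k (wStar h w H)).1 (toB h f) := by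
  change toB h (w * f - f * w + specialMap h hh H f) = _
  rw [map_add, toB_specialMap, innerDer_apply, wStar, map_sub, map_mul, map_mul]
  noncomm_ring

/-- If `D` is the restriction to `A_h` of `[u, -]` with `u ∈ 𝓑`, and `σ` extends `ρ`, then `ρ`
commutes with `D` exactly when `σ u - u` commutes with `A_h`. -/
theorem mem_isotropyGroup_iff [CharZero k] {h : k[X]} (hh : h ≠ 0) {D : Der k (A h)} {u : B h}
    (hD : ∀ f, toB h (D.1 f) = u * toB h f - toB h f * u) {ρ : A h ≃ₐ[k] A h}
    {σ : B h ≃ₐ[k] B h} (hσ : IsExtension ρ σ) :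
    ρ ∈ isotropyGroup D ↔ ∃ c : k, σ u - u = algebraMap k (B h) c := by
  have hl : ∀ f, toB h (ρ (D.1 f)) = σ u * toB h (ρ f) - toB h (ρ f) * σ u := fun f => by
    rw [← hσ, hD, map_sub, map_mul, map_mul, hσ]
  constructor
  · intro hρ
    apply exists_eq_algebraMap_of_commute hh
    intro a
    obtain ⟨f, rfl⟩ := ρ.surjective a
    have h1 := hl f
    rw [show ρ (D.1 f) = D.1 (ρ f) from hρ f, hD] at h1
    rw [sub_mul, mul_sub, sub_eq_sub_iff_sub_eq_sub]
    exact h1.symm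
  · rintro ⟨c, hc⟩ f
    apply toB_injective hh
    rw [hl, hD, sub_eq_iff_eq_add.1 hc, add_mul, mul_add, Algebra.commutes]
    abel

theorem isotropyGroup_eq [IsAlgClosed k] [CharZero k] {h : k[X]} (hh : h ≠ 0)
    (hN : h.natDegree ≠ 0) {D : Der k (A h)} {u : B h}
    (hD : ∀ f, toB h (D.1 f) = u * toB h f - toB h f * u) :
    (isotropyGroup D : Set (A h ≃ₐ[k] A h)) =
      {ρ | ∃ σ : B h ≃ₐ[k] B h, IsExtension ρ σ ∧ ∃ c : k, σ u - u = algebraMap k (B h) c} := by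
  ext ρ
  constructor
  · intro hρ
    obtain ⟨σ, hσ, -⟩ := existsUnique_extension hN ρ
    exact ⟨σ, hσ, (mem_isotropyGroup_iff hh hD hσ).1 hρ⟩
  · rintro ⟨σ, hσ, hc⟩
    exact (mem_isotropyGroup_iff hh hD hσ).2 hc

end OreExt

end

theorem mainTheorem4 {k : Type*} [Field k] [IsAlgClosed k] [CharZero k] (h : k[X]) (hh : h ≠ 0)
    (hN : 2 ≤ h.natDegree) :
    (∀ ρ : OreExt.A h ≃ₐ[k] OreExt.A h, ∃! σ : OreExt.B h ≃ₐ[k] OreExt.B h,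
      OreExt.IsExtension ρ σ) ∧
    ∀ H : OreExt.A h, OreExt.IsSpecial h H →
      (∀ w : OreExt.A h,
        (∀ f : OreExt.A h,
          OreExt.toB h ((OreExt.innerDer k w + OreExt.specialDer h hh H).1 f) =
            (OreExt.innerDer k (OreExt.wStar h w H)).1 (OreExt.toB h f)) ∧
        (OreExt.isotropyGroup (OreExt.innerDer k w + OreExt.specialDer h hh H) :
            Set (OreExt.A h ≃ₐ[k] OreExt.A h)) =
          {ρ | ∃ σ : OreExt.B h ≃ₐ[k] OreExt.B h, OreExt.IsExtension ρ σ ∧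
            ∃ c : k, σ (OreExt.wStar h w H) - OreExt.wStar h w H =
              algebraMap k (OreExt.B h) c}) ∧
      (OreExt.isotropyGroup (OreExt.specialDer h hh H) : Set (OreExt.A h ≃ₐ[k] OreExt.A h)) =
        {ρ | ∃ σ : OreExt.B h ≃ₐ[k] OreExt.B h, OreExt.IsExtension ρ σ ∧
          ∃ c : k, σ (OreExt.psiInvMul h H) - OreExt.psiInvMul h H =
            algebraMap k (OreExt.B h) c} := by
  have hN0 : h.natDegree ≠ 0 := by omega
  refine ⟨OreExt.existsUnique_extension hN0, fun H _ => ⟨fun w =>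
    ⟨OreExt.toB_innerDer_add_specialDer hh w H, ?_⟩, ?_⟩⟩
  · exact OreExt.isotropyGroup_eq hh hN0 (OreExt.toB_innerDer_add_specialDer hh w H)
  · exact OreExt.isotropyGroup_eq hh hN0 (OreExt.toB_specialMap h hh H)
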